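/- **Setting.** Let $d\ge 1$, let $\Omega\subset\mathbb R^d$ be a bounded open set (for instance a bounded Lipschitz domain), and let $\nu,T>0$. All function spaces are real. $H_0^1(\Omega)$ is the closure of $C_c^\infty(\Omega)$ in $H^1(\Omega)$, with inner product $(g,h)_{H_0^1}=(\nabla g,\nabla h)_{L^2}$. Let $N\ge 2$, $\Delta t=T/(N-1)$, and $\partial u^n=(u^{n+1}-u^n)/\Delta t$. Let $V^h\subset H_0^1(\Omega)$ be a finite-dimensional subspace, let $f^n\in L^2(\Omega)$, and let $u^1,\dots,u^N\in V^h$ satisfy the backward Euler scheme $$(\partial u^n,v)_{L^2}+\nu(\nabla u^{n+1},\nabla v)_{L^2}=(f^{n+1},v)_{L^2}\qquad\forall v\in V^h,\ 1\le n\le N-1.$$ *POD.* Let $w^1=u^1$, $\gamma_1=1$ and $w^{j+1}=\partial u^{j}$, $\gamma_{j+1}=\Delta t$ for $1\le j\le N-1$. The POD operator $K:\mathbb R^N\to L^2(\Omega)$, $Kg=\sum_{j=1}^N\gamma_j g^j w^j$, where $\mathbb R^N$ carries the inner product $\sum_j\gamma_j g^jh^j$, has positive singular values $\lambda_1^{1/2}\ge\dots\ge\lambda_s^{1/2}>0$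 and left singular vectors $\varphi_1,\dots,\varphi_s\in V^h$, which are orthonormal in $L^2(\Omega)$. These are the POD modes; the list may be continued by further $L^2$-orthonormal elements of $V^h$, belonging to the singular value $0$. Let $r$ be at most the number of modes, $V_r^h=\operatorname{span}\{\varphi_1,\dots,\varphi_r\}$, let $\Pi_r w=\sum_{k=1}^r(w,\varphi_k)_{L^2}\varphi_k$, and let $R_r$ be the Ritz projection onto $V_r^h$, i.e. $(\nabla(w-R_rw),\nabla v_r)_{L^2}=0$ for all $v_r\in V_r^h$. *ROM.* Let $u_r^1,\dots,u_r^N\in V_r^h$ satisfy $u_r^1=\Pi_ru^1$ and $$(\partial u_r^n,v_r)_{L^2}+\nu(\nabla u_r^{n+1},\nabla v_r)_{L^2}=(f^{n+1},v_r)_{L^2}\qquad\forall v_r\in V_r^h,\ 1\le n\le N-1.$$ Put $e^k=u^k-u_r^k$ and $\phi_r^1=u_r^1-R_ru^1$. For the error norm $Y=L^2(\Omega)$ put $$\Lambda_r=\sum_{i=r+1}^s\lambda_i\|\varphi_i-R_r\varphi_i\|_{L^2}^2,\qquad \Lambda_r^1=\|\phi_r^1\|_{L^2}^2,$$ and for the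 error norm $Y=H_0^1(\Omega)$ put $$\Lambda_r=\sum_{i=r+1}^s\lambda_i\big(\|\varphi_i-R_r\varphi_i\|_{L^2}^2+\|\nabla(\varphi_i-R_r\varphi_i)\|_{L^2}^2\big),\qquad \Lambda_r^1=\|\phi_r^1\|_{H_0^1}^2 .$$ *Optimality.* A discretization consists of $N$, $V^h$, $(f^n)$, $(u^n)$, the POD basis, $r$ and $(u_r^n)$ as above. For a class $\mathcal F$ of discretizations (with $\Omega,\nu,T$ fixed), $\Lambda_r+\Lambda_r^1$ is *optimal-I* on $\mathcal F$ if there is a constant $C$ such that, for every member of $\mathcal F$, $$\Lambda_r+\Lambda_r^1\le C\sum_{i=r+1}^s\lambda_i\|\varphi_i\|_Y^2,$$ and *optimal-II* on $\mathcal F$ if there is a constant $C$ such that, for every member of $\mathcal F$, $$\Lambda_r+\Lambda_r^1\le C\sum_{i=r+1}^s\lambda_i\|\varphi_i-\Pi_r^Y\varphi_i\|_Y^2,$$ where $\Pi_r^Y$ is the $Y$-orthogonal projection onto $V_r^h$. **Theorem.** 1. ($Y=L^2$.) There is $C>0$, the same for all discretizations, with $\max_{1\le k\le N}\|e^k\|_{L^2}^2\le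 C(\Lambda_r+\Lambda_r^1)$. If $\mathcal F$ is a class of discretizations for which there is a constant $B$ with $\|\varphi_i-R_r\varphi_i\|_{L^2}\le B$ for $r+1\le i\le s$ and all members of $\mathcal F$, then $\Lambda_r+\Lambda_r^1$ is optimal-I on $\mathcal F$, and also optimal-II on $\mathcal F$. Moreover, on every class $\mathcal F$ (bounded in this sense or not), optimal-I and optimal-II are equivalent for $Y=L^2$. 2. ($Y=H_0^1$.) There is $C>0$, the same for all discretizations, with $\max_{1\le k\le N}\|\nabla e^k\|_{L^2}^2\le C(\Lambda_r+\Lambda_r^1)$, and $\Lambda_r+\Lambda_r^1$ is optimal-I on the class of all discretizations. -/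

import Mathlib

open MeasureTheory Finset
open scoped ContDiff Gradient

noncomputable section

namespace PODROM

/-! ### The spaces `L²(Ω)` and `H₀¹(Ω)` (real valued) -/

/-- Euclidean space `ℝ^d`. -/
abbrev E (d : ℕ) : Type := EuclideanSpace ℝ (Fin d)

/-- The Hilbert space `L²(Ω)`. -/
abbrev L2 {d : ℕ} (Ω : Set (E d)) : Type := Lp ℝ 2 ((volume : Measure (E d)).restrict Ω)

/-- The Hilbert space `L²(Ω; ℝ^d)` of square integrable vector fields. -/
abbrev L2Vec {d : ℕ} (Ω : Set (E d)) : Type := Lp (E d) 2 ((volume : Measure (E d)).restrict Ω)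

/-- `ψ ∈ C_c^∞(Ω)`. -/
structure IsTestFunction {d : ℕ} (Ω : Set (E d)) (ψ : E d → ℝ) : Prop where
  smooth : ContDiff ℝ ∞ ψ
  compact : HasCompactSupport ψ
  support : tsupport ψ ⊆ Ω

/-- The pairs `(ψ, ∇ψ) ∈ L²(Ω) × L²(Ω; ℝ^d)` with `ψ ∈ C_c^∞(Ω)`. -/
def testPairs {d : ℕ} (Ω : Set (E d)) : Set (L2 Ω × L2Vec Ω) :=
  {p | ∃ ψ : E d → ℝ, IsTestFunction Ω ψ ∧
    (p.1 =ᵐ[(volume : Measure (E d)).restrict Ω] ψ) ∧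
    (p.2 =ᵐ[(volume : Measure (E d)).restrict Ω] fun x => ∇ ψ x)}

/-- `H₀¹(Ω)`, the closure of `C_c^∞(Ω)` in the `H¹` norm. A function `u ∈ H₀¹(Ω)` is recorded together
with its weak gradient, as the pair `(u, ∇u)`; the gradient is determined by `u`, see
`toL2_injective`. -/
def H10Space {d : ℕ} (Ω : Set (E d)) : Submodule ℝ (L2 Ω × L2Vec Ω) :=
  (Submodule.span ℝ (testPairs Ω)).topologicalClosure

/-- `H₀¹(Ω)` as a type. Its two relevant norms are `‖toL2 u‖` and `‖grad u‖`. -/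
abbrev H10 {d : ℕ} (Ω : Set (E d)) : Type := H10Space Ω

/-- The inclusion `H₀¹(Ω) → L²(Ω)`; thus `‖toL2 u‖ = ‖u‖_{L²}`. -/
def toL2 {d : ℕ} (Ω : Set (E d)) : H10 Ω →ₗ[ℝ] L2 Ω :=
  (LinearMap.fst ℝ (L2 Ω) (L2Vec Ω)).comp (H10Space Ω).subtype

/-- The weak gradient `H₀¹(Ω) → L²(Ω; ℝ^d)`. The inner product of `H₀¹(Ω)` is `(∇u, ∇v)_{L²}`,
so `‖grad u‖ = ‖u‖_{H₀¹}`. -/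
def grad {d : ℕ} (Ω : Set (E d)) : H10 Ω →ₗ[ℝ] L2Vec Ω :=
  (LinearMap.snd ℝ (L2 Ω) (L2Vec Ω)).comp (H10Space Ω).subtype

/-- Integration by parts between an element of `H₀¹(Ω)` and a test function: `grad` is the weak
gradient. -/
theorem integral_by_parts {d : ℕ} {Ω : Set (E d)} (u : H10 Ω) {χ : E d → ℝ}
    (hχ : IsTestFunction Ω χ) (v : E d) :
    ∫ x in Ω, inner ℝ (χ x • v) (grad Ω u x) = - ∫ x in Ω, fderiv ℝ χ x v * toL2 Ω u x := by
  set μ := (volume : Measure (E d)).restrict Ω with hμ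
  have hfc : Continuous (fun x => fderiv ℝ χ x v) :=
    (hχ.smooth.continuous_fderiv (by simp)).clm_apply continuous_const
  have hfs : HasCompactSupport (fun x => fderiv ℝ χ x v) := hχ.compact.fderiv_apply (𝕜 := ℝ) v
  have hX : MemLp (fun x => χ x • v) 2 μ :=
    (hχ.smooth.continuous.smul continuous_const).memLp_of_hasCompactSupport hχ.compact.smul_right
  have hY : MemLp (fun x => fderiv ℝ χ x v) 2 μ := hfc.memLp_of_hasCompactSupport hfs
  have hA : ∀ q : L2Vec Ω, inner ℝ (hX.toLp _) q = ∫ x in Ω, inner ℝ (χ x • v) (q x) := by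
    intro q
    rw [L2.inner_def]
    refine integral_congr_ae ?_
    filter_upwards [hX.coeFn_toLp] with x hx
    rw [hx]
  have hB : ∀ q : L2 Ω, inner ℝ (hY.toLp _) q = ∫ x in Ω, fderiv ℝ χ x v * q x := by
    intro q
    rw [L2.inner_def]
    refine integral_congr_ae ?_
    filter_upwards [hY.coeFn_toLp] with x hx
    rw [hx]
    simp [mul_comm]
  let L : L2 Ω × L2Vec Ω →L[ℝ] ℝ :=
    (innerSL ℝ (hX.toLp _)).comp (ContinuousLinearMap.snd ℝ _ _) +
      (innerSL ℝ (hY.toLp _)).comp (ContinuousLinearMap.fst ℝ _ _)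
  have hL : H10Space Ω ≤ LinearMap.ker L.toLinearMap := by
    refine Submodule.topologicalClosure_minimal _ (Submodule.span_le.2 ?_) L.isClosed_ker
    rintro p ⟨ψ, hψ, h1, h2⟩
    change inner ℝ (hX.toLp _) p.2 + inner ℝ (hY.toLp _) p.1 = (0 : ℝ)
    rw [hA, hB]
    have e1 : ∫ x in Ω, inner ℝ (χ x • v) (p.2 x) = ∫ x, χ x * fderiv ℝ ψ x v := by
      rw [← setIntegral_eq_integral_of_forall_compl_eq_zero (s := Ω)
        (f := fun x => χ x * fderiv ℝ ψ x v)]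
      · refine integral_congr_ae ?_
        filter_upwards [h2] with x hx
        rw [hx, real_inner_smul_left, inner_gradient_right]
        simp
      · intro x hx
        rw [image_eq_zero_of_notMem_tsupport (fun h => hx (hχ.support h)), zero_mul]
    have e2 : ∫ x in Ω, fderiv ℝ χ x v * p.1 x = ∫ x, fderiv ℝ χ x v * ψ x := by
      rw [← setIntegral_eq_integral_of_forall_compl_eq_zero (s := Ω)
        (f := fun x => fderiv ℝ χ x v * ψ x)]
      · refine integral_congr_ae ?_
        filter_upwards [h1] with x hx
        rw [hx]
      · intro x hx
        rw [image_eq_zero_of_notMem_tsupport (fun h => hx (hψ.support h)), mul_zero]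
    have hfcψ : Continuous (fun x => fderiv ℝ ψ x v) :=
      (hψ.smooth.continuous_fderiv (by simp)).clm_apply continuous_const
    rw [e1, e2, integral_mul_fderiv_eq_neg_fderiv_mul_of_integrable, neg_add_cancel]
    · exact (hfc.mul hψ.smooth.continuous).integrable_of_hasCompactSupport hfs.mul_right
    · exact (hχ.smooth.continuous.mul hfcψ).integrable_of_hasCompactSupport hχ.compact.mul_right
    · exact (hχ.smooth.continuous.mul hψ.smooth.continuous).integrable_of_hasCompactSupport
        hχ.compact.mul_right
    · exact fun x _ => hχ.smooth.differentiable (by simp) x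
    · exact fun x _ => hψ.smooth.differentiable (by simp) x
  have h0 : inner ℝ (hX.toLp _) (grad Ω u) + inner ℝ (hY.toLp _) (toL2 Ω u) = (0 : ℝ) := hL u.2
  rw [hA, hB] at h0
  linarith

/-- An element of `H₀¹(Ω)` is determined by the underlying function. -/
theorem toL2_injective {d : ℕ} {Ω : Set (E d)} (hΩ : IsOpen Ω) :
    Function.Injective (toL2 Ω) := by
  rw [injective_iff_map_eq_zero]
  intro u hu
  have hz : ∀ᵐ x ∂((volume : Measure (E d)).restrict Ω), toL2 Ω u x = 0 := by
    rw [hu]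
    exact Lp.coeFn_zero _ _ _
  have hg : ∀ᵐ x ∂(volume : Measure (E d)), x ∈ Ω → grad Ω u x = 0 := by
    refine hΩ.ae_eq_zero_of_integral_contDiff_smul_eq_zero
      (locallyIntegrableOn_of_locallyIntegrable_restrict
        ((Lp.memLp (grad Ω u)).locallyIntegrable (by norm_num))) ?_
    intro χ h1 h2 h3
    have hχ2 : MemLp χ 2 ((volume : Measure (E d)).restrict Ω) :=
      h1.continuous.memLp_of_hasCompactSupport h2
    have hint : Integrable (fun x => χ x • grad Ω u x) ((volume : Measure (E d)).restrict Ω) :=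
      memLp_one_iff_integrable.1 ((Lp.memLp (grad Ω u)).smul hχ2)
    rw [← setIntegral_eq_integral_of_forall_compl_eq_zero (s := Ω)
      (f := fun x => χ x • grad Ω u x)]
    · refine ext_inner_left ℝ fun v => ?_
      rw [← integral_inner hint v, inner_zero_right]
      have hp := integral_by_parts u ⟨h1, h2, h3⟩ v
      have h0 : ∫ x in Ω, fderiv ℝ χ x v * toL2 Ω u x = 0 :=
        integral_eq_zero_of_ae (hz.mono fun x hx => by simp [hx])
      rw [h0, neg_zero] at hp
      rw [← hp]
      refine integral_congr_ae (.of_forall fun x => ?_)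
      simp only [real_inner_smul_left, real_inner_smul_right]
    · intro x hx
      rw [image_eq_zero_of_notMem_tsupport (fun h => hx (h3 h)), zero_smul]
  have hg' : grad Ω u = 0 := by
    rw [Lp.eq_zero_iff_ae_eq_zero]
    exact (ae_restrict_iff' hΩ.measurableSet).2 hg
  exact Subtype.ext (Prod.ext hu hg')

/-! ### Time stepping -/

/-- The time step `Δt = T / (N - 1)`. -/
def timeStep (T : ℝ) (N : ℕ) : ℝ := T / ((N : ℝ) - 1)

/-- The difference quotient `∂uⁿ = (uⁿ⁺¹ - uⁿ) / Δt`. -/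
def diffQuot {d : ℕ} {Ω : Set (E d)} (T : ℝ) (N : ℕ) (u : ℕ → H10 Ω) (n : ℕ) : H10 Ω :=
  (timeStep T N)⁻¹ • (u (n + 1) - u n)

/-- `(uⁿ)_{1 ≤ n ≤ N}` lies in the subspace `W ⊆ H₀¹(Ω)` and solves the backward Euler Galerkin scheme
`(∂uⁿ, v)_{L²} + ν (∇uⁿ⁺¹, ∇v)_{L²} = (fⁿ⁺¹, v)_{L²}` for all `v ∈ W`, `1 ≤ n ≤ N - 1`. -/
structure IsBackwardEuler {d : ℕ} {Ω : Set (E d)} (ν T : ℝ) (N : ℕ) (W : Submodule ℝ (H10 Ω))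
    (f : ℕ → L2 Ω) (u : ℕ → H10 Ω) : Prop where
  mem : ∀ n, 1 ≤ n → n ≤ N → u n ∈ W
  scheme : ∀ n, 1 ≤ n → n + 1 ≤ N → ∀ v ∈ W,
    inner ℝ (toL2 Ω (diffQuot T N u n)) (toL2 Ω v)
      + ν * inner ℝ (grad Ω (u (n + 1))) (grad Ω v) = inner ℝ (f (n + 1)) (toL2 Ω v)

/-! ### POD with the first snapshot and all the difference quotients, POD space `L²(Ω)` -/

/-- The POD data `w¹ = u¹`, `wʲ⁺¹ = ∂uʲ` for `1 ≤ j ≤ N - 1`. -/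
def podData {d : ℕ} {Ω : Set (E d)} (T : ℝ) (N : ℕ) (u : ℕ → H10 Ω) (j : ℕ) : H10 Ω :=
  if j = 1 then u 1 else diffQuot T N u (j - 1)

/-- The weights `γ₁ = 1`, `γⱼ = Δt` for `2 ≤ j ≤ N`. -/
def podWeight (T : ℝ) (N : ℕ) (j : ℕ) : ℝ := if j = 1 then 1 else timeStep T N

/-- The inner product `(g, h)_S = ∑_{j=1}^N γⱼ gʲ hʲ` of the weighted space `S = ℝ^N`. Only the
entries `1, …, N` of the sequences matter. -/
def weightedInner (T : ℝ) (N : ℕ) (g h : ℕ → ℝ) : ℝ :=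
  ∑ j ∈ Icc 1 N, podWeight T N j * (g j * h j)

/-- The POD operator `K₁ : S → L²(Ω)`, `K₁ g = ∑_{j=1}^N γⱼ gʲ wʲ = g¹ u¹ + ∑_{j=1}^{N-1} Δt gʲ⁺¹ ∂uʲ`. -/
def podOperator {d : ℕ} {Ω : Set (E d)} (T : ℝ) (N : ℕ) (u : ℕ → H10 Ω) (g : ℕ → ℝ) : L2 Ω :=
  ∑ j ∈ Icc 1 N, (podWeight T N j * g j) • toL2 Ω (podData T N u j)

/-- `(σₖ, gₖ, φₖ)_{1 ≤ k ≤ s}` is a singular value decomposition of the POD operator, with exactly the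
positive singular values `σ₁ ≥ … ≥ σₛ > 0`. The functions `φ₁, …, φₘ` (`m ≥ s`) are the POD modes: they
are orthonormal in `L²(Ω)`, and the first `s` are the left singular vectors. (The modes beyond `s`,
if there are any, belong to the singular value zero.) -/
structure IsPODBasis {d : ℕ} {Ω : Set (E d)} (T : ℝ) (N : ℕ) (u : ℕ → H10 Ω) (s m : ℕ)
    (σ : ℕ → ℝ) (g : ℕ → ℕ → ℝ) (φ : ℕ → H10 Ω) : Prop where
  s_le_m : s ≤ m
  pos : ∀ k, 1 ≤ k → k ≤ s → 0 < σ k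
  anti : ∀ k l, 1 ≤ k → k ≤ l → l ≤ s → σ l ≤ σ k
  orthonormal_right : ∀ k l, 1 ≤ k → k ≤ s → 1 ≤ l → l ≤ s →
    weightedInner T N (g k) (g l) = if k = l then 1 else 0
  orthonormal_left : ∀ k l, 1 ≤ k → k ≤ m → 1 ≤ l → l ≤ m →
    inner ℝ (toL2 Ω (φ k)) (toL2 Ω (φ l)) = if k = l then (1 : ℝ) else 0
  svd : ∀ h : ℕ → ℝ, podOperator T N u h =
    ∑ k ∈ Icc 1 s, (σ k * weightedInner T N h (g k)) • toL2 Ω (φ k)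

/-! ### Projections -/

/-- `span {φ₁, …, φᵣ}`. -/
def modeSpan {d : ℕ} {Ω : Set (E d)} (φ : ℕ → H10 Ω) (r : ℕ) : Submodule ℝ (H10 Ω) :=
  Submodule.span ℝ (φ '' Set.Icc 1 r)

instance modeSpan_finite {d : ℕ} {Ω : Set (E d)} (φ : ℕ → H10 Ω) (r : ℕ) :
    FiniteDimensional ℝ (modeSpan φ r) :=
  FiniteDimensional.span_of_finite ℝ ((Set.finite_Icc 1 r).image φ)

/-- The POD projection `Πᵣ w = ∑_{k=1}^r (w, φₖ)_{L²} φₖ`. -/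
def podProj {d : ℕ} {Ω : Set (E d)} (φ : ℕ → H10 Ω) (r : ℕ) (w : H10 Ω) : H10 Ω :=
  ∑ k ∈ Icc 1 r, (inner ℝ (toL2 Ω w) (toL2 Ω (φ k)) : ℝ) • φ k

theorem exists_ritz {d : ℕ} {Ω : Set (E d)} (W : Submodule ℝ (H10 Ω)) [FiniteDimensional ℝ W]
    (w : H10 Ω) : ∃ v ∈ W, ∀ z ∈ W, inner ℝ (grad Ω (w - v)) (grad Ω z) = (0 : ℝ) := by
  obtain ⟨v, hv, hv'⟩ := (W.map (grad Ω)).starProjection_apply_mem (grad Ω w)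
  refine ⟨v, hv, fun z hz => ?_⟩
  rw [map_sub, hv']
  exact (W.map (grad Ω)).starProjection_inner_eq_zero _ _ ⟨z, hz, rfl⟩

/-- The Ritz projection `R w` of `w` onto a finite dimensional subspace `W`: the element of `W` with
`(∇(w - R w), ∇z)_{L²} = 0` for all `z ∈ W`. -/
def ritz {d : ℕ} {Ω : Set (E d)} (W : Submodule ℝ (H10 Ω)) [FiniteDimensional ℝ W]
    (w : H10 Ω) : H10 Ω :=
  (exists_ritz W w).choose

theorem ritz_mem {d : ℕ} {Ω : Set (E d)} (W : Submodule ℝ (H10 Ω)) [FiniteDimensional ℝ W]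
    (w : H10 Ω) : ritz W w ∈ W :=
  (exists_ritz W w).choose_spec.1

theorem ritz_orthogonal {d : ℕ} {Ω : Set (E d)} (W : Submodule ℝ (H10 Ω))
    [FiniteDimensional ℝ W] (w z : H10 Ω) (hz : z ∈ W) :
    inner ℝ (grad Ω (w - ritz W w)) (grad Ω z) = (0 : ℝ) :=
  (exists_ritz W w).choose_spec.2 z hz

/-! ### The reduced order model -/

/-- A finite element solution of the heat equation on `Ω × [0, T]` with diffusion coefficient `ν`,
its POD basis with respect to `L²(Ω)`, and the resulting reduced order model. -/
structure Model {d : ℕ} (Ω : Set (E d)) (ν T : ℝ) where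
  /-- number of time levels -/
  N : ℕ
  two_le_N : 2 ≤ N
  /-- the conforming finite element space `V^h ⊂ H₀¹(Ω)` -/
  Vh : Submodule ℝ (H10 Ω)
  finite_Vh : FiniteDimensional ℝ Vh
  /-- `f n` is the forcing at time level `n` -/
  f : ℕ → L2 Ω
  /-- the finite element solution, which supplies the snapshots -/
  u : ℕ → H10 Ω
  u_euler : IsBackwardEuler ν T N Vh f u
  /-- number of positive POD singular values -/
  s : ℕ
  /-- number of POD modes -/
  m : ℕ
  /-- the POD singular values -/
  σ : ℕ → ℝ
  /-- the right singular vectors -/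
  g : ℕ → ℕ → ℝ
  /-- the POD modes -/
  φ : ℕ → H10 Ω
  pod : IsPODBasis T N u s m σ g φ
  φ_mem : ∀ k, 1 ≤ k → k ≤ m → φ k ∈ Vh
  /-- number of modes used in the reduced order model -/
  r : ℕ
  r_le : r ≤ m
  /-- the solution of the reduced order model -/
  ur : ℕ → H10 Ω
  ur_init : ur 1 = podProj φ r (u 1)
  ur_euler : IsBackwardEuler ν T N (modeSpan φ r) f ur

namespace Model

variable {d : ℕ} {Ω : Set (E d)} {ν T : ℝ}

/-- The POD eigenvalues `λᵢ = σᵢ²`. -/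
def eigenvalue (D : Model Ω ν T) (i : ℕ) : ℝ := D.σ i ^ 2

/-- The Ritz projection `Rᵣ` onto `V_r^h = span {φ₁, …, φᵣ}`. -/
def R (D : Model Ω ν T) (w : H10 Ω) : H10 Ω := ritz (modeSpan D.φ D.r) w

/-- The ROM error `eᵏ = uᵏ - uᵣᵏ`. -/
def err (D : Model Ω ν T) (k : ℕ) : H10 Ω := D.u k - D.ur k

/-- The initial discretization error `φᵣ¹ = uᵣ¹ - Rᵣ u¹`. -/
def initErr (D : Model Ω ν T) : H10 Ω := D.ur 1 - D.R (D.u 1)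

/-- `Λᵣ` for the error norm `Y = L²`: `∑_{i=r+1}^s λᵢ ‖φᵢ - Rᵣ φᵢ‖²_{L²}`. -/
def lamL2 (D : Model Ω ν T) : ℝ :=
  ∑ i ∈ Icc (D.r + 1) D.s, D.eigenvalue i * ‖toL2 Ω (D.φ i - D.R (D.φ i))‖ ^ 2

/-- `Λᵣ¹` for the error norm `Y = L²`: `‖φᵣ¹‖²_{L²}`. -/
def lamInitL2 (D : Model Ω ν T) : ℝ := ‖toL2 Ω D.initErr‖ ^ 2

/-- `Λᵣ` for the error norm `Y = H₀¹`:
`∑_{i=r+1}^s λᵢ (‖φᵢ - Rᵣ φᵢ‖²_{L²} + ‖∇(φᵢ - Rᵣ φᵢ)‖²_{L²})`. -/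
def lamH10 (D : Model Ω ν T) : ℝ :=
  ∑ i ∈ Icc (D.r + 1) D.s, D.eigenvalue i *
    (‖toL2 Ω (D.φ i - D.R (D.φ i))‖ ^ 2 + ‖grad Ω (D.φ i - D.R (D.φ i))‖ ^ 2)

/-- `Λᵣ¹` for the error norm `Y = H₀¹`: `‖φᵣ¹‖²_{H₀¹}`. -/
def lamInitH10 (D : Model Ω ν T) : ℝ := ‖grad Ω D.initErr‖ ^ 2

end Model

/-! ### Optimality

The error norm space `Y` enters through a linear map `ι` from `H₀¹(Ω)` to a Hilbert space with
`‖w‖_Y = ‖ι w‖`: `ι = toL2` for `Y = L²`, and `ι = grad` for `Y = H₀¹`. Constants are uniform over a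
class `F` of models on the fixed domain `Ω` with fixed `ν` and `T`, so they are independent of every
discretization parameter (`Δt`, `V^h`, `r`, the data and the modes). -/

section Optimality

variable {d : ℕ} {Ω : Set (E d)} {ν T : ℝ} {Y : Type} [NormedAddCommGroup Y]
  [InnerProductSpace ℝ Y]

/-- `max_{1 ≤ k ≤ N} ‖eᵏ‖_Y² ≤ C (Λᵣ + Λᵣ¹)` with `C` uniform over `F`. -/
def HasErrorBound (F : Set (Model Ω ν T)) (ι : H10 Ω →ₗ[ℝ] Y) (lam lamInit : Model Ω ν T → ℝ) :
    Prop :=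
  ∃ C : ℝ, 0 < C ∧ ∀ D ∈ F, ∀ k, 1 ≤ k → k ≤ D.N →
    ‖ι (D.err k)‖ ^ 2 ≤ C * (lam D + lamInit D)

/-- Optimal-I: `Λᵣ + Λᵣ¹ ≤ C ∑_{i=r+1}^s λᵢ ‖φᵢ‖_Y²`. -/
def OptimalI (F : Set (Model Ω ν T)) (ι : H10 Ω →ₗ[ℝ] Y) (lam lamInit : Model Ω ν T → ℝ) :
    Prop :=
  ∃ C : ℝ, ∀ D ∈ F, lam D + lamInit D ≤
    C * ∑ i ∈ Icc (D.r + 1) D.s, D.eigenvalue i * ‖ι (D.φ i)‖ ^ 2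

/-- Optimal-II: `Λᵣ + Λᵣ¹ ≤ C ∑_{i=r+1}^s λᵢ ‖φᵢ - Πᵣ^Y φᵢ‖_Y²`, where `Πᵣ^Y` is the `Y`-orthogonal
projection onto `span {φ₁, …, φᵣ}`. -/
def OptimalII (F : Set (Model Ω ν T)) (ι : H10 Ω →ₗ[ℝ] Y) (lam lamInit : Model Ω ν T → ℝ) :
    Prop :=
  ∃ C : ℝ, ∀ D ∈ F, lam D + lamInit D ≤
    C * ∑ i ∈ Icc (D.r + 1) D.s, D.eigenvalue i *
      ‖ι (D.φ i) - ((modeSpan D.φ D.r).map ι).starProjection (ι (D.φ i))‖ ^ 2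

end Optimality

end PODROM

end

/-! Two mechanisms carry the theorem: a weighted POD identity that holds for every linear map, and
an energy estimate for the discrete part of the error.

POD identity. The SVD gives `wʲ = ∑ₖ σₖ gₖʲ φₖ`, and orthonormality of the `gₖ` in the weighted
space yields `∑ⱼ γⱼ ‖L wʲ‖² = ∑ₖ λₖ ‖L φₖ‖²` (`sum_podData`). All sums are finite, so `L` need not
be continuous; if it kills the first `r` modes, only the tail remains. Moreover `uᵏ = ∑_{j≤k} γⱼ wʲ`
telescopes, so Cauchy–Schwarz turns the sum over time into a bound at each time level with factor
`∑ⱼ γⱼ = 1 + T` (`norm_map_u_sq_le`).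

Error bounds. Split `eᵏ = (uᵏ - Rᵣ uᵏ) - φᵣᵏ`. The first part is the POD identity for `L = ι ∘ (1 -
Rᵣ)`. The second solves backward Euler in `V_r^h` with load `(1 - Rᵣ) ∂uⁿ` (`error_equation`).
Testing with `φᵣⁿ⁺¹` gives the `L²` bound, testing with the increment gives the `H₀¹` bound; the
load sums to the same POD tail.

Optimality. Applying the identity to `Πᵣ - Rᵣ` bounds `Λᵣ¹` by `∑_{i>r} λᵢ ‖Rᵣ φᵢ‖_Y²`. For `Y =
H₀¹` the Ritz projection is a contraction and Poincaré handles the `L²` part; for `Y = L²` the bound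
`B` takes over this role. -/

noncomputable section

namespace PODROM

/-! ### The Poincaré inequality on `H₀¹(Ω)` -/

section Poincare

variable {d : ℕ} {Ω : Set (E d)}

/-- Squared `L²` norm as an integral, for a given representative. -/
theorem norm_sq_eq_setIntegral {F : Type*} [NormedAddCommGroup F] [InnerProductSpace ℝ F]
    (p : Lp F 2 ((volume : Measure (E d)).restrict Ω)) {ψ : E d → F}
    (h : p =ᵐ[(volume : Measure (E d)).restrict Ω] ψ) :
    ‖p‖ ^ 2 = ∫ x in Ω, ‖ψ x‖ ^ 2 := by
  rw [← real_inner_self_eq_norm_sq, L2.inner_def]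
  refine integral_congr_ae ?_
  filter_upwards [h] with x hx
  rw [hx, real_inner_self_eq_norm_sq]

theorem IsTestFunction.add {ψ χ : E d → ℝ} (hψ : IsTestFunction Ω ψ) (hχ : IsTestFunction Ω χ) :
    IsTestFunction Ω (ψ + χ) :=
  ⟨hψ.smooth.add hχ.smooth, hψ.compact.add hχ.compact,
    (tsupport_add ψ χ).trans (Set.union_subset hψ.support hχ.support)⟩

theorem IsTestFunction.const_smul {ψ : E d → ℝ} (hψ : IsTestFunction Ω ψ) (c : ℝ) :
    IsTestFunction Ω (c • ψ) :=
  ⟨hψ.smooth.const_smul c, hψ.compact.smul_left (f := fun _ => c),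
    (tsupport_smul_subset_right (fun _ => c) ψ).trans hψ.support⟩

theorem isTestFunction_zero : IsTestFunction Ω (0 : E d → ℝ) :=
  ⟨contDiff_const, HasCompactSupport.zero, by simp⟩

/-- Since the test pairs are already a subspace, `H₀¹(Ω)` is their plain closure, and an inequality
closed in `(u, ∇u)` need only be checked on test functions. -/
theorem span_testPairs_subset : (Submodule.span ℝ (testPairs Ω) : Set (L2 Ω × L2Vec Ω)) ⊆
    testPairs Ω := by
  intro p hp
  induction hp using Submodule.span_induction with
  | mem p hp => exact hp
  | zero =>
    refine ⟨0, isTestFunction_zero, Lp.coeFn_zero _ _ _, ?_⟩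
    filter_upwards [Lp.coeFn_zero (E d) 2 ((volume : Measure (E d)).restrict Ω)] with x hx
    simpa [gradient] using hx
  | add p q _ _ hp hq =>
    obtain ⟨ψ, hψ, h1, h2⟩ := hp
    obtain ⟨χ, hχ, k1, k2⟩ := hq
    refine ⟨ψ + χ, hψ.add hχ, ?_, ?_⟩
    · filter_upwards [Lp.coeFn_add p.1 q.1, h1, k1] with x hx h k
      rw [Prod.fst_add, hx, Pi.add_apply, Pi.add_apply, h, k]
    · filter_upwards [Lp.coeFn_add p.2 q.2, h2, k2] with x hx h k
      rw [Prod.snd_add, hx, Pi.add_apply, h, k]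
      simp only [gradient]
      rw [fderiv_add (hψ.smooth.differentiable (by simp) x) (hχ.smooth.differentiable (by simp) x),
        map_add]
  | smul c p _ hp =>
    obtain ⟨ψ, hψ, h1, h2⟩ := hp
    refine ⟨c • ψ, hψ.const_smul c, ?_, ?_⟩
    · filter_upwards [Lp.coeFn_smul c p.1, h1] with x hx h
      rw [Prod.smul_fst, hx, Pi.smul_apply, Pi.smul_apply, h]
    · filter_upwards [Lp.coeFn_smul c p.2, h2] with x hx h
      rw [Prod.smul_snd, hx, Pi.smul_apply, h]
      simp only [gradient]
      rw [fderiv_const_smul (hψ.smooth.differentiable (by simp) x)]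
      simp

/-- `∫ ψ² = -2 ∫ ℓ ψ ∂ᵥψ` for a linear functional `ℓ` with `ℓ v = 1`. -/
theorem integral_sq_eq {ψ : E d → ℝ} (hψ : IsTestFunction Ω ψ) (l : E d →L[ℝ] ℝ) (v : E d)
    (hlv : l v = 1) : ∫ x, ψ x ^ 2 = ∫ x, -2 * (l x * ψ x * fderiv ℝ ψ x v) := by
  have hc := hψ.smooth.continuous
  have hfc : Continuous (fun x => fderiv ℝ ψ x v) :=
    (hψ.smooth.continuous_fderiv (by simp)).clm_apply continuous_const
  have hfd : ∀ x, fderiv ℝ (fun x => l x * ψ x) x v = l x * fderiv ℝ ψ x v + ψ x := by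
    intro x
    rw [fderiv_fun_mul l.differentiableAt (hψ.smooth.differentiable (by simp) x)]
    simp [hlv]
  have i1 : Integrable (fun x => l x * ψ x * fderiv ℝ ψ x v) :=
    ((l.continuous.mul hc).mul hfc).integrable_of_hasCompactSupport
      (hψ.compact.mul_left.mul_right)
  have i2 : Integrable (fun x => ψ x ^ 2) := by
    simp_rw [pow_two]
    exact (hc.mul hc).integrable_of_hasCompactSupport hψ.compact.mul_right
  -- Integrate `ℓψ · ∂ᵥψ` by parts: `∂ᵥ(ℓψ) = ℓ ∂ᵥψ + ψ` reproduces the integral once more and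
  -- leaves `∫ ψ²`.
  have key := integral_mul_fderiv_eq_neg_fderiv_mul_of_integrable (μ := (volume : Measure (E d)))
    (f := fun x => l x * ψ x) (g := ψ) (v := v) ?_ i1 ?_ ?_ ?_
  · simp_rw [hfd] at key
    have e : ∫ x, (l x * fderiv ℝ ψ x v + ψ x) * ψ x =
        (∫ x, l x * ψ x * fderiv ℝ ψ x v) + ∫ x, ψ x ^ 2 := by
      rw [← integral_add i1 i2]
      congr 1 with x
      ring
    rw [e] at key
    rw [integral_const_mul]
    linarith
  · simp_rw [hfd]
    refine (i1.add i2).congr (.of_forall fun x => ?_)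
    simp only [Pi.add_apply]
    ring
  · exact ((l.continuous.mul hc).mul hc).integrable_of_hasCompactSupport hψ.compact.mul_left
  · exact fun x _ => l.differentiableAt.mul (hψ.smooth.differentiable (by simp) x)
  · exact fun x _ => hψ.smooth.differentiable (by simp) x

/-- Take for `ℓ` the `i`-th coordinate, at most `M` in absolute value on `Ω`, in `integral_sq_eq`;
Young's inequality then absorbs half of `∫ ψ²`. -/
theorem poincare_testFunction {ψ : E d → ℝ} (hψ : IsTestFunction Ω ψ) (i : Fin d) {M : ℝ}
    (hM : ∀ x ∈ Ω, ‖x‖ ≤ M) :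
    ∫ x in Ω, ‖ψ x‖ ^ 2 ≤ (2 * M) ^ 2 * ∫ x in Ω, ‖∇ ψ x‖ ^ 2 := by
  have hc := hψ.smooth.continuous
  have hfc := hψ.smooth.continuous_fderiv (by simp)
  set v : E d := EuclideanSpace.single i 1 with hv
  have hvn : ‖v‖ = 1 := by simp [hv]
  set l : E d →L[ℝ] ℝ := innerSL ℝ v with hl
  have hg : ∀ x, ‖∇ ψ x‖ = ‖fderiv ℝ ψ x‖ := fun x => by simp [gradient]
  simp_rw [hg]
  have hz : ∀ x, x ∉ Ω → ψ x = 0 := fun x hx =>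
    image_eq_zero_of_notMem_tsupport fun h => hx (hψ.support h)
  have hz' : ∀ x, x ∉ Ω → fderiv ℝ ψ x = 0 := fun x hx =>
    image_eq_zero_of_notMem_tsupport fun h => hx (hψ.support (tsupport_fderiv_subset ℝ h))
  rw [setIntegral_eq_integral_of_forall_compl_eq_zero (fun x hx => by simp [hz x hx]),
    setIntegral_eq_integral_of_forall_compl_eq_zero (fun x hx => by simp [hz' x hx])]
  simp_rw [Real.norm_eq_abs, sq_abs]
  have i1 : Integrable (fun x => ψ x ^ 2) := by
    simp_rw [pow_two]
    exact (hc.mul hc).integrable_of_hasCompactSupport hψ.compact.mul_right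
  have i2 : Integrable (fun x => ‖fderiv ℝ ψ x‖ ^ 2) := by
    simp_rw [pow_two]
    exact (hfc.norm.mul hfc.norm).integrable_of_hasCompactSupport
      (hψ.compact.fderiv (𝕜 := ℝ)).norm.mul_right
  have i3 : Integrable (fun x => -2 * (l x * ψ x * fderiv ℝ ψ x v)) :=
    (((l.continuous.mul hc).mul (hfc.clm_apply continuous_const)).integrable_of_hasCompactSupport
      (hψ.compact.mul_left.mul_right)).const_mul _
  have hle : ∫ x, -2 * (l x * ψ x * fderiv ℝ ψ x v) ≤
      ∫ x, (1 / 2 * ψ x ^ 2 + 2 * M ^ 2 * ‖fderiv ℝ ψ x‖ ^ 2) := by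
    refine integral_mono i3 ((i1.const_mul _).add (i2.const_mul _)) fun x => ?_
    by_cases hx : x ∈ Ω
    · have hD : |fderiv ℝ ψ x v| ≤ ‖fderiv ℝ ψ x‖ := by
        simpa [hvn] using (fderiv ℝ ψ x).le_opNorm v
      have hlx : |l x| ≤ M := by
        have := abs_real_inner_le_norm v x
        rw [hvn, one_mul] at this
        exact this.trans (hM x hx)
      have hp : |l x * fderiv ℝ ψ x v| ≤ M * ‖fderiv ℝ ψ x‖ := by
        rw [abs_mul]
        exact mul_le_mul hlx hD (abs_nonneg _) ((abs_nonneg _).trans hlx)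
      have hp2 := sq_le_sq' (abs_le.1 hp).1 (abs_le.1 hp).2
      -- This square is Young's inequality `-2ψy ≤ ψ²/2 + 2y²` with `y = ℓ ∂ᵥψ`.
      have := sq_nonneg (ψ x + 2 * (l x * fderiv ℝ ψ x v))
      simp only
      nlinarith
    · simp [hz x hx, hz' x hx]
  rw [← integral_sq_eq hψ l v (by simp [hl, hvn]), integral_add (i1.const_mul _) (i2.const_mul _),
    integral_const_mul, integral_const_mul] at hle
  nlinarith

/-- The Poincaré inequality. -/
theorem exists_poincare (hd : 1 ≤ d) (hΩb : Bornology.IsBounded Ω) :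
    ∃ P : ℝ, 0 ≤ P ∧ ∀ u : H10 Ω, ‖toL2 Ω u‖ ≤ P * ‖grad Ω u‖ := by
  obtain ⟨M, hM0, hM⟩ := hΩb.exists_pos_norm_le
  refine ⟨2 * M, by positivity, ?_⟩
  have hcl : IsClosed {p : L2 Ω × L2Vec Ω | ‖p.1‖ ≤ 2 * M * ‖p.2‖} :=
    isClosed_le (by fun_prop) (by fun_prop)
  have hsub : closure (Submodule.span ℝ (testPairs Ω) : Set (L2 Ω × L2Vec Ω)) ⊆
      {p | ‖p.1‖ ≤ 2 * M * ‖p.2‖} := by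
    refine closure_minimal (fun p hp => ?_) hcl
    obtain ⟨ψ, hψ, h1, h2⟩ := span_testPairs_subset hp
    refine (abs_le_of_sq_le_sq' (b := 2 * M * ‖p.2‖) ?_ (by positivity)).2
    rw [mul_pow, norm_sq_eq_setIntegral _ h1, norm_sq_eq_setIntegral _ h2]
    exact poincare_testFunction hψ ⟨0, hd⟩ hM
  exact fun u => hsub u.2

theorem grad_injective (hd : 1 ≤ d) (hΩ : IsOpen Ω) (hΩb : Bornology.IsBounded Ω) :
    Function.Injective (grad Ω) := by
  obtain ⟨P, -, hP⟩ := exists_poincare hd hΩb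
  rw [injective_iff_map_eq_zero]
  intro u hu
  have := hP u
  rw [hu, norm_zero, mul_zero, norm_le_zero_iff] at this
  exact toL2_injective hΩ (by rw [this, map_zero])

end Poincare

/-! ### The Ritz projection as a linear map -/

section Ritz

variable {d : ℕ} {Ω : Set (E d)}

/-- The difference of two candidates lies in `W` and is gradient-orthogonal to itself. As `ritz`
comes from a choice, this uniqueness is what makes it linear. -/
theorem ritz_eq (hinj : Function.Injective (grad Ω)) (W : Submodule ℝ (H10 Ω))
    [FiniteDimensional ℝ W] {w v : H10 Ω} (hv : v ∈ W)
    (h : ∀ z ∈ W, inner ℝ (grad Ω (w - v)) (grad Ω z) = (0 : ℝ)) : ritz W w = v := by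
  have hm : v - ritz W w ∈ W := W.sub_mem hv (ritz_mem W w)
  have h1 := ritz_orthogonal W w _ hm
  have h2 := h _ hm
  have h3 : inner ℝ (grad Ω (v - ritz W w)) (grad Ω (v - ritz W w)) = (0 : ℝ) := by
    rw [show grad Ω (v - ritz W w) = grad Ω (w - ritz W w) - grad Ω (w - v) by
      rw [← map_sub]; congr 1; abel] at *
    rw [inner_sub_left, h1, h2, sub_zero]
  rw [inner_self_eq_zero, map_eq_zero_iff _ hinj] at h3
  exact (sub_eq_zero.1 h3).symm

/-- The Ritz projection as a linear map. -/
def ritzLinear (hinj : Function.Injective (grad Ω)) (W : Submodule ℝ (H10 Ω))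
    [FiniteDimensional ℝ W] : H10 Ω →ₗ[ℝ] H10 Ω where
  toFun := ritz W
  map_add' x y := by
    refine ritz_eq hinj W (W.add_mem (ritz_mem W x) (ritz_mem W y)) fun z hz => ?_
    rw [add_sub_add_comm, map_add, inner_add_left, ritz_orthogonal W x z hz,
      ritz_orthogonal W y z hz, add_zero]
  map_smul' c x := by
    refine ritz_eq hinj W (W.smul_mem c (ritz_mem W x)) fun z hz => ?_
    rw [RingHom.id_apply, ← smul_sub, map_smul, real_inner_smul_left, ritz_orthogonal W x z hz,
      mul_zero]

theorem ritz_self (hinj : Function.Injective (grad Ω)) (W : Submodule ℝ (H10 Ω))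
    [FiniteDimensional ℝ W] {w : H10 Ω} (hw : w ∈ W) : ritz W w = w :=
  ritz_eq hinj W hw fun z _ => by simp

/-- Pythagoras: both `Rᵣ` and `1 - Rᵣ` are contractions in the gradient norm. -/
theorem norm_grad_sq_eq (W : Submodule ℝ (H10 Ω)) [FiniteDimensional ℝ W] (w : H10 Ω) :
    ‖grad Ω w‖ ^ 2 = ‖grad Ω (w - ritz W w)‖ ^ 2 + ‖grad Ω (ritz W w)‖ ^ 2 := by
  have h := ritz_orthogonal W w _ (ritz_mem W w)
  have e : grad Ω w = grad Ω (w - ritz W w) + grad Ω (ritz W w) := by rw [← map_add]; simp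
  rw [e, norm_add_sq_real, h]
  ring

/-- The POD projection as a linear map. -/
def podProjLinear (φ : ℕ → H10 Ω) (r : ℕ) : H10 Ω →ₗ[ℝ] H10 Ω where
  toFun := podProj φ r
  map_add' x y := by simp [podProj, inner_add_left, add_smul, Finset.sum_add_distrib]
  map_smul' c x := by simp [podProj, real_inner_smul_left, mul_smul, Finset.smul_sum]

end Ritz

/-! ### Energy estimates for one step of the scheme -/

section Energy

variable {X Z : Type*} [NormedAddCommGroup X] [InnerProductSpace ℝ X]
  [NormedAddCommGroup Z] [InnerProductSpace ℝ Z]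

theorem half_norm_sq_sub_le_inner (a b : X) :
    (‖b‖ ^ 2 - ‖a‖ ^ 2) / 2 ≤ inner ℝ (b - a) b := by
  have h := norm_sub_sq_real b a
  have h0 := sq_nonneg ‖b - a‖
  rw [inner_sub_left, real_inner_self_eq_norm_sq, real_inner_comm]
  linarith

theorem norm_add_sq_le (a b : X) : ‖a + b‖ ^ 2 ≤ 2 * ‖a‖ ^ 2 + 2 * ‖b‖ ^ 2 := by
  nlinarith [parallelogram_law_with_norm ℝ a b, sq_nonneg ‖a - b‖]

theorem norm_sub_sq_le (a b : X) : ‖a - b‖ ^ 2 ≤ 2 * ‖a‖ ^ 2 + 2 * ‖b‖ ^ 2 := by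
  simpa [sub_eq_add_neg] using norm_add_sq_le a (-b)

/-- Via Poincaré and Young, diffusion absorbs the test function in the load term. Hence `‖a‖²` keeps
coefficient 1 and no Gronwall argument is needed. -/
theorem energy_step {τ ν P : ℝ} (hτ : 0 < τ) (hν : 0 < ν) {a b h : X} {G : Z}
    (hP : ‖b‖ ≤ P * ‖G‖)
    (heq : inner ℝ (τ⁻¹ • (b - a)) b + ν * inner ℝ G G = inner ℝ h b) :
    ‖b‖ ^ 2 ≤ ‖a‖ ^ 2 + P ^ 2 / (2 * ν) * (τ * ‖h‖ ^ 2) := by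
  have h1 := half_norm_sq_sub_le_inner a b
  have h2 := real_inner_le_norm h b
  have h3 : ‖h‖ * ‖b‖ ≤ ‖h‖ * (P * ‖G‖) := mul_le_mul_of_nonneg_left hP (norm_nonneg _)
  have h4 : ‖h‖ * (P * ‖G‖) ≤ ν * ‖G‖ ^ 2 + P ^ 2 * ‖h‖ ^ 2 / (4 * ν) := by
    have : ν * ‖G‖ ^ 2 + P ^ 2 * ‖h‖ ^ 2 / (4 * ν) - ‖h‖ * (P * ‖G‖) =
        (2 * ν * ‖G‖ - P * ‖h‖) ^ 2 / (4 * ν) := by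
      field_simp
      ring
    have : 0 ≤ (2 * ν * ‖G‖ - P * ‖h‖) ^ 2 / (4 * ν) := by positivity
    linarith
  rw [real_inner_smul_left, real_inner_self_eq_norm_sq] at heq
  have h5 : τ⁻¹ * inner ℝ (b - a) b ≤ P ^ 2 * ‖h‖ ^ 2 / (4 * ν) := by linarith
  rw [inv_mul_le_iff₀ hτ] at h5
  have h6 : P ^ 2 / (2 * ν) * (τ * ‖h‖ ^ 2) = 2 * (τ * (P ^ 2 * ‖h‖ ^ 2 / (4 * ν))) := by
    field_simp
    ring
  linarith

/-- Here the time-difference term `τ⁻¹ ‖δ‖²` absorbs the load, without Poincaré. The load stays in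
the norm of `X`, whence the `L²` summand in `Λᵣ` for `H₀¹`. -/
theorem energy_step_increment {τ ν : ℝ} (hτ : 0 < τ) (hν : 0 < ν) {δ h : X} {G G' : Z}
    (heq : inner ℝ (τ⁻¹ • δ) δ + ν * inner ℝ G' (G' - G) = inner ℝ h δ) :
    ‖G'‖ ^ 2 ≤ ‖G‖ ^ 2 + 1 / (2 * ν) * (τ * ‖h‖ ^ 2) := by
  have h1 := half_norm_sq_sub_le_inner G G'
  rw [real_inner_comm] at h1
  have h2 := real_inner_le_norm h δ
  have h4 : ‖h‖ * ‖δ‖ ≤ τ⁻¹ * ‖δ‖ ^ 2 + τ * ‖h‖ ^ 2 / 4 := by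
    have : τ⁻¹ * ‖δ‖ ^ 2 + τ * ‖h‖ ^ 2 / 4 - ‖h‖ * ‖δ‖ = τ⁻¹ * (‖δ‖ - τ * ‖h‖ / 2) ^ 2 := by
      field_simp
      ring
    have : 0 ≤ τ⁻¹ * (‖δ‖ - τ * ‖h‖ / 2) ^ 2 := by positivity
    linarith
  rw [real_inner_smul_left, real_inner_self_eq_norm_sq] at heq
  have h5 : ν * inner ℝ G' (G' - G) ≤ τ * ‖h‖ ^ 2 / 4 := by linarith
  have h6 : ν * ((‖G'‖ ^ 2 - ‖G‖ ^ 2) / 2) ≤ ν * inner ℝ G' (G' - G) :=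
    mul_le_mul_of_nonneg_left h1 hν.le
  have h7 : ν * (1 / (2 * ν) * (τ * ‖h‖ ^ 2)) = τ * ‖h‖ ^ 2 / 2 := by
    field_simp
  refine le_of_mul_le_mul_left ?_ hν
  rw [mul_add, h7]
  linarith

end Energy

/-! ### The POD identity and its consequences -/

theorem timeStep_pos {T : ℝ} (hT : 0 < T) {N : ℕ} (hN : 2 ≤ N) : 0 < timeStep T N := by
  have : (2 : ℝ) ≤ N := by exact_mod_cast hN
  exact div_pos hT (by linarith)

theorem podWeight_pos {T : ℝ} (hT : 0 < T) {N : ℕ} (hN : 2 ≤ N) (j : ℕ) :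
    0 < podWeight T N j := by
  unfold podWeight
  split_ifs
  · exact one_pos
  · exact timeStep_pos hT hN

theorem sum_podWeight (T : ℝ) {N : ℕ} (hN : 2 ≤ N) : ∑ j ∈ Icc 1 N, podWeight T N j = 1 + T := by
  have h : ∀ n : ℕ, ∑ j ∈ Icc 1 (n + 1), podWeight T N j = 1 + n * timeStep T N := by
    intro n
    induction n with
    | zero => simp [podWeight]
    | succ n ih =>
      rw [Finset.sum_Icc_succ_top (by omega), ih, podWeight, if_neg (by omega)]
      push_cast
      ring
  obtain ⟨n, rfl⟩ : ∃ n, N = n + 1 := ⟨N - 1, by omega⟩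
  have hn : (n : ℝ) ≠ 0 := by
    have : n ≠ 0 := by omega
    exact_mod_cast this
  rw [h, timeStep]
  push_cast
  rw [add_sub_cancel_right]
  field_simp

namespace Model

variable {d : ℕ} {Ω : Set (E d)} {ν T : ℝ}

/-- Evaluate the SVD at the `j`-th unit vector and divide by `γⱼ`. Injectivity of `toL2` lifts the
identity from `L²` to `H₀¹`, so that gradients and Ritz projections can be applied to it. -/
theorem podData_eq (hΩ : IsOpen Ω) (hT : 0 < T) (D : Model Ω ν T) {j : ℕ} (hj : j ∈ Icc 1 D.N) :
    podData T D.N D.u j = ∑ k ∈ Icc 1 D.s, (D.σ k * D.g k j) • D.φ k := by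
  have h := D.pod.svd (Pi.single j 1)
  have hw := podWeight_pos hT D.two_le_N j
  have hW : ∀ q : ℕ → ℝ, weightedInner T D.N (Pi.single j 1) q = podWeight T D.N j * q j := by
    intro q
    rw [weightedInner, Finset.sum_eq_single_of_mem j hj]
    · simp
    · intro i _ hij
      simp [hij]
  rw [podOperator, Finset.sum_eq_single_of_mem j hj] at h
  · apply toL2_injective hΩ
    simp only [hW, Pi.single_eq_same, mul_one] at h
    rw [map_sum, ← smul_right_inj hw.ne', h, Finset.smul_sum]
    refine Finset.sum_congr rfl fun k _ => ?_
    rw [map_smul, smul_smul]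
    congr 1
    ring
  · intro i _ hij
    simp [hij]

/-- `∑ⱼ γⱼ ‖L wʲ‖² = ∑ₖ λₖ ‖L φₖ‖²` for every linear map `L`. -/
theorem sum_podData (hΩ : IsOpen Ω) (hT : 0 < T) (D : Model Ω ν T) {Y : Type*}
    [NormedAddCommGroup Y] [InnerProductSpace ℝ Y] (L : H10 Ω →ₗ[ℝ] Y) :
    ∑ j ∈ Icc 1 D.N, podWeight T D.N j * ‖L (podData T D.N D.u j)‖ ^ 2 =
      ∑ k ∈ Icc 1 D.s, D.eigenvalue k * ‖L (D.φ k)‖ ^ 2 := by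
  have h1 : ∀ j ∈ Icc 1 D.N, podWeight T D.N j * ‖L (podData T D.N D.u j)‖ ^ 2 =
      ∑ k ∈ Icc 1 D.s, ∑ l ∈ Icc 1 D.s, podWeight T D.N j * (D.g k j * D.g l j) *
        (D.σ k * D.σ l * inner ℝ (L (D.φ k)) (L (D.φ l))) := by
    intro j hj
    rw [D.podData_eq hΩ hT hj, map_sum, ← real_inner_self_eq_norm_sq, sum_inner, Finset.mul_sum]
    refine Finset.sum_congr rfl fun k _ => ?_
    rw [inner_sum, Finset.mul_sum]
    refine Finset.sum_congr rfl fun l _ => ?_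
    rw [map_smul, map_smul, real_inner_smul_left, real_inner_smul_right]
    ring
  rw [Finset.sum_congr rfl h1, Finset.sum_comm]
  refine Finset.sum_congr rfl fun k hk => ?_
  -- With the sum over `j` innermost, weighted orthonormality of `gₖ, gₗ` leaves only `l = k`; the
  -- images `L φₖ` need not be orthogonal.
  rw [Finset.sum_comm, Finset.sum_eq_single_of_mem k hk]
  · rw [← Finset.sum_mul]
    have h := D.pod.orthonormal_right k k (mem_Icc.1 hk).1 (mem_Icc.1 hk).2 (mem_Icc.1 hk).1
      (mem_Icc.1 hk).2
    rw [if_pos rfl] at h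
    rw [weightedInner] at h
    rw [h, real_inner_self_eq_norm_sq, eigenvalue]
    ring
  · intro l hl hlk
    rw [← Finset.sum_mul]
    have h := D.pod.orthonormal_right k l (mem_Icc.1 hk).1 (mem_Icc.1 hk).2 (mem_Icc.1 hl).1
      (mem_Icc.1 hl).2
    rw [if_neg hlk.symm] at h
    rw [weightedInner] at h
    rw [h, zero_mul]

/-- The POD identity for a linear map vanishing on the first `r` modes. -/
theorem sum_podData_tail (hΩ : IsOpen Ω) (hT : 0 < T) (D : Model Ω ν T) {Y : Type*}
    [NormedAddCommGroup Y] [InnerProductSpace ℝ Y] (L : H10 Ω →ₗ[ℝ] Y)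
    (hL : ∀ k, 1 ≤ k → k ≤ D.r → L (D.φ k) = 0) :
    ∑ j ∈ Icc 1 D.N, podWeight T D.N j * ‖L (podData T D.N D.u j)‖ ^ 2 =
      ∑ k ∈ Icc (D.r + 1) D.s, D.eigenvalue k * ‖L (D.φ k)‖ ^ 2 := by
  rw [D.sum_podData hΩ hT L]
  refine (Finset.sum_subset (Finset.Icc_subset_Icc_left (by omega)) fun k hk hk' => ?_).symm
  rw [mem_Icc] at hk hk'
  rw [hL k hk.1 (by omega)]
  simp

theorem u_succ_eq_sum (hT : 0 < T) (D : Model Ω ν T) (k : ℕ) :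
    D.u (k + 1) = ∑ j ∈ Icc 1 (k + 1), podWeight T D.N j • podData T D.N D.u j := by
  induction k with
  | zero => simp [podWeight, podData]
  | succ k ih =>
    rw [Finset.sum_Icc_succ_top (by omega), ← ih, podWeight, podData, if_neg (by omega),
      if_neg (by omega), diffQuot, smul_inv_smul₀ (timeStep_pos hT D.two_le_N).ne']
    simp

/-- Telescoping, the triangle inequality, and Cauchy–Schwarz with weights `γⱼ` of total mass `1 +
T`. -/
theorem norm_map_u_sq_le (hT : 0 < T) (D : Model Ω ν T) {Y : Type*}
    [NormedAddCommGroup Y] [InnerProductSpace ℝ Y] (L : H10 Ω →ₗ[ℝ] Y) {k : ℕ} (hk : 1 ≤ k)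
    (hkN : k ≤ D.N) : ‖L (D.u k)‖ ^ 2 ≤
      (1 + T) * ∑ j ∈ Icc 1 D.N, podWeight T D.N j * ‖L (podData T D.N D.u j)‖ ^ 2 := by
  have hw := fun j => (podWeight_pos hT D.two_le_N j).le
  obtain ⟨k, rfl⟩ : ∃ n, k = n + 1 := ⟨k - 1, by omega⟩
  have hsub : Icc 1 (k + 1) ⊆ Icc 1 D.N := Finset.Icc_subset_Icc_right hkN
  have h1 : ‖L (D.u (k + 1))‖ ≤
      ∑ j ∈ Icc 1 D.N, podWeight T D.N j * ‖L (podData T D.N D.u j)‖ := by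
    rw [D.u_succ_eq_sum hT k, map_sum]
    refine (norm_sum_le _ _).trans ?_
    refine (Finset.sum_le_sum fun j _ => ?_).trans
      (Finset.sum_le_sum_of_subset_of_nonneg hsub fun j _ _ => by have := hw j; positivity)
    rw [map_smul, norm_smul, Real.norm_eq_abs, abs_of_nonneg (hw j)]
  refine (pow_le_pow_left₀ (norm_nonneg _) h1 2).trans ?_
  rw [← sum_podWeight T D.two_le_N]
  refine Finset.sum_sq_le_sum_mul_sum_of_sq_le_mul _ (fun j _ => hw j)
    (fun j _ => by have := hw j; positivity) fun j _ => le_of_eq ?_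
  ring

theorem norm_map_init_sq_le (hT : 0 < T) (D : Model Ω ν T) {Y : Type*}
    [NormedAddCommGroup Y] [InnerProductSpace ℝ Y] (L : H10 Ω →ₗ[ℝ] Y) : ‖L (D.u 1)‖ ^ 2 ≤
      ∑ j ∈ Icc 1 D.N, podWeight T D.N j * ‖L (podData T D.N D.u j)‖ ^ 2 := by
  have h := Finset.single_le_sum (s := Icc 1 D.N)
    (f := fun j => podWeight T D.N j * ‖L (podData T D.N D.u j)‖ ^ 2)
    (fun j _ => by have := (podWeight_pos hT D.two_le_N j).le; positivity)
    (mem_Icc.2 ⟨le_rfl, by have := D.two_le_N; omega⟩)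
  simpa [podWeight, podData] using h

/-! ### Orthogonality of the modes and the projections onto them -/

theorem eigenvalue_nonneg (D : Model Ω ν T) (i : ℕ) : 0 ≤ D.eigenvalue i := sq_nonneg _

theorem mode_mem (D : Model Ω ν T) {k : ℕ} (h1 : 1 ≤ k) (hk : k ≤ D.r) :
    D.φ k ∈ modeSpan D.φ D.r :=
  Submodule.subset_span ⟨k, ⟨h1, hk⟩, rfl⟩

theorem modeSpan_le (D : Model Ω ν T) : modeSpan D.φ D.r ≤ D.Vh := by
  refine Submodule.span_le.2 ?_
  rintro _ ⟨k, ⟨h1, hk⟩, rfl⟩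
  exact D.φ_mem k h1 (hk.trans D.r_le)

theorem podProj_mode (D : Model Ω ν T) {k : ℕ} (h1 : 1 ≤ k) (hk : k ≤ D.r) :
    podProj D.φ D.r (D.φ k) = D.φ k := by
  rw [podProj, Finset.sum_eq_single_of_mem k (mem_Icc.2 ⟨h1, hk⟩)]
  · rw [D.pod.orthonormal_left k k h1 (hk.trans D.r_le) h1 (hk.trans D.r_le), if_pos rfl, one_smul]
  · intro l hl hlk
    rw [mem_Icc] at hl
    rw [D.pod.orthonormal_left k l h1 (hk.trans D.r_le) hl.1 (hl.2.trans D.r_le),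
      if_neg hlk.symm, zero_smul]

theorem podProj_mode_of_lt (D : Model Ω ν T) {k : ℕ} (hk : D.r < k) (hks : k ≤ D.s) :
    podProj D.φ D.r (D.φ k) = 0 := by
  refine Finset.sum_eq_zero fun l hl => ?_
  rw [mem_Icc] at hl
  rw [D.pod.orthonormal_left k l (by omega) (hks.trans D.pod.s_le_m) hl.1 (hl.2.trans D.r_le),
    if_neg (by omega), zero_smul]

theorem norm_mode_sq (D : Model Ω ν T) {k : ℕ} (hk : 1 ≤ k) (hks : k ≤ D.s) :
    ‖toL2 Ω (D.φ k)‖ ^ 2 = 1 := by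
  have h := D.pod.orthonormal_left k k hk (hks.trans D.pod.s_le_m) hk (hks.trans D.pod.s_le_m)
  rwa [if_pos rfl, real_inner_self_eq_norm_sq] at h

theorem starProjection_mode_of_lt (D : Model Ω ν T) {k : ℕ} (hk : D.r < k) (hks : k ≤ D.s) :
    ((modeSpan D.φ D.r).map (toL2 Ω)).starProjection (toL2 Ω (D.φ k)) = 0 := by
  refine (Submodule.starProjection_apply_eq_zero_iff _).2 ?_
  rw [Submodule.mem_orthogonal']
  rintro _ ⟨v, hv, rfl⟩
  induction hv using Submodule.span_induction with
  | mem v hv =>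
    obtain ⟨l, hl, rfl⟩ := hv
    rw [D.pod.orthonormal_left k l (by omega) (hks.trans D.pod.s_le_m) hl.1 (hl.2.trans D.r_le),
      if_neg (by have := hl.2; omega)]
  | zero => simp
  | add v w _ _ hv hw => rw [map_add, inner_add_right, hv, hw, add_zero]
  | smul c v _ hv => rw [map_smul, real_inner_smul_right, hv, mul_zero]

/-- For `i > r` the mode `φᵢ` is `L²`-orthogonal to `V_r^h`, so the two right-hand sides agree term
by term, with the same `C`. -/
theorem optimalI_iff_optimalII_L2 (F : Set (Model Ω ν T)) (lam lamInit : Model Ω ν T → ℝ) :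
    OptimalI F (toL2 Ω) lam lamInit ↔ OptimalII F (toL2 Ω) lam lamInit := by
  refine exists_congr fun C => forall₂_congr fun D _ => ?_
  refine iff_of_eq (congrArg (fun t => lam D + lamInit D ≤ C * t) ?_)
  refine Finset.sum_congr rfl fun i hi => ?_
  rw [mem_Icc] at hi
  rw [D.starProjection_mode_of_lt (by omega) hi.2, sub_zero]

/-! ### The error equation -/

/-- The map `w ↦ w - Rᵣ w`. -/
def ritzErr (hinj : Function.Injective (grad Ω)) (D : Model Ω ν T) : H10 Ω →ₗ[ℝ] H10 Ω :=
  LinearMap.id - ritzLinear hinj (modeSpan D.φ D.r)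

theorem ritzErr_apply (hinj : Function.Injective (grad Ω)) (D : Model Ω ν T) (w : H10 Ω) :
    D.ritzErr hinj w = w - D.R w := rfl

theorem ritzErr_mode (hinj : Function.Injective (grad Ω)) (D : Model Ω ν T) {k : ℕ} (h1 : 1 ≤ k)
    (hk : k ≤ D.r) : D.ritzErr hinj (D.φ k) = 0 := by
  rw [ritzErr_apply, R, ritz_self hinj _ (D.mode_mem h1 hk), sub_self]

/-- The discretization error `φᵣⁿ = uᵣⁿ - Rᵣ uⁿ`. -/
def discErr (D : Model Ω ν T) (n : ℕ) : H10 Ω := D.ur n - D.R (D.u n)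

theorem discErr_mem (D : Model Ω ν T) {n : ℕ} (h1 : 1 ≤ n) (hn : n ≤ D.N) :
    D.discErr n ∈ modeSpan D.φ D.r :=
  Submodule.sub_mem _ (D.ur_euler.mem n h1 hn) (ritz_mem _ _)

theorem err_eq (hinj : Function.Injective (grad Ω)) (D : Model Ω ν T) (n : ℕ) :
    D.err n = D.ritzErr hinj (D.u n) - D.discErr n := by
  rw [ritzErr_apply, err, discErr]
  abel

theorem discErr_eq (hinj : Function.Injective (grad Ω)) (D : Model Ω ν T) (n : ℕ) :
    D.discErr n = D.ur n - D.u n + D.ritzErr hinj (D.u n) := by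
  rw [ritzErr_apply, discErr]
  abel

/-- Subtract the two schemes on `V_r^h ⊆ V^h`. Ritz orthogonality removes the gradient of `uⁿ⁺¹ - Rᵣ
uⁿ⁺¹`, and linearity of `Rᵣ` turns the remaining load into the Ritz error of `∂uⁿ = wⁿ⁺¹`. -/
theorem error_equation (hinj : Function.Injective (grad Ω)) (D : Model Ω ν T) {n : ℕ}
    (h1 : 1 ≤ n) (hn : n + 1 ≤ D.N) {v : H10 Ω} (hv : v ∈ modeSpan D.φ D.r) :
    inner ℝ ((timeStep T D.N)⁻¹ • (toL2 Ω (D.discErr (n + 1)) - toL2 Ω (D.discErr n))) (toL2 Ω v)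
      + ν * inner ℝ (grad Ω (D.discErr (n + 1))) (grad Ω v)
      = inner ℝ (toL2 Ω (D.ritzErr hinj (podData T D.N D.u (n + 1)))) (toL2 Ω v) := by
  have e1 := D.u_euler.scheme n h1 hn v (D.modeSpan_le hv)
  have e2 := D.ur_euler.scheme n h1 hn v hv
  have e3 : inner ℝ (grad Ω (D.ritzErr hinj (D.u (n + 1)))) (grad Ω v) = (0 : ℝ) :=
    ritz_orthogonal _ _ v hv
  have e4 : podData T D.N D.u (n + 1) = diffQuot T D.N D.u n := by
    rw [podData, if_neg (by omega), Nat.add_sub_cancel]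
  rw [e4, D.discErr_eq hinj, D.discErr_eq hinj]
  simp only [diffQuot, map_add, map_sub, map_smul, inner_add_left, inner_sub_left,
    real_inner_smul_left] at e1 e2 e3 ⊢
  linear_combination e2 - e1 + ν * e3

theorem le_init_add_sum (hT : 0 < T) (D : Model Ω ν T) {a b : ℕ → ℝ} {c : ℝ} (hc : 0 ≤ c)
    (hb : ∀ j, 0 ≤ b j)
    (h : ∀ n, 1 ≤ n → n + 1 ≤ D.N → a (n + 1) ≤ a n + c * (timeStep T D.N * b (n + 1)))
    {k : ℕ} (hk : 1 ≤ k) (hkN : k ≤ D.N) :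
    a k ≤ a 1 + c * ∑ j ∈ Icc 1 D.N, podWeight T D.N j * b j := by
  have hw := fun j => mul_nonneg (podWeight_pos hT D.two_le_N j).le (hb j)
  have key : a k ≤ a 1 + c * ∑ j ∈ Icc 1 k, podWeight T D.N j * b j := by
    induction k, hk using Nat.le_induction with
    -- The term `j = 1` comes from no time step; adding it is free and completes the POD sum.
    | base => exact le_add_of_nonneg_right (mul_nonneg hc (Finset.sum_nonneg fun j _ => hw j))
    | succ k hk ih =>
      have h1 := ih (by omega)
      have h2 := h k hk hkN
      rw [Finset.sum_Icc_succ_top (by omega)]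
      have h3 : podWeight T D.N (k + 1) = timeStep T D.N := by rw [podWeight, if_neg (by omega)]
      rw [h3, mul_add]
      linarith
  refine key.trans ?_
  gcongr
  exact fun j _ _ => hw j

theorem norm_discErr_sq_le (hinj : Function.Injective (grad Ω)) (hν : 0 < ν) (hT : 0 < T) {P : ℝ}
    (hP : ∀ u : H10 Ω, ‖toL2 Ω u‖ ≤ P * ‖grad Ω u‖) (D : Model Ω ν T) {k : ℕ} (hk : 1 ≤ k)
    (hkN : k ≤ D.N) :
    ‖toL2 Ω (D.discErr k)‖ ^ 2 ≤ D.lamInitL2 + P ^ 2 / (2 * ν) *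
      ∑ j ∈ Icc 1 D.N, podWeight T D.N j *
        ‖toL2 Ω (D.ritzErr hinj (podData T D.N D.u j))‖ ^ 2 := by
  refine D.le_init_add_sum hT (a := fun n => ‖toL2 Ω (D.discErr n)‖ ^ 2) (by positivity)
    (fun j => sq_nonneg _) (fun n h1 hn => ?_) hk hkN
  exact energy_step (timeStep_pos hT D.two_le_N) hν (hP _)
    (D.error_equation hinj h1 hn (D.discErr_mem (by omega) hn))

theorem norm_grad_discErr_sq_le (hinj : Function.Injective (grad Ω)) (hν : 0 < ν) (hT : 0 < T)
    (D : Model Ω ν T) {k : ℕ} (hk : 1 ≤ k) (hkN : k ≤ D.N) :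
    ‖grad Ω (D.discErr k)‖ ^ 2 ≤ D.lamInitH10 + 1 / (2 * ν) *
      ∑ j ∈ Icc 1 D.N, podWeight T D.N j *
        ‖toL2 Ω (D.ritzErr hinj (podData T D.N D.u j))‖ ^ 2 := by
  refine D.le_init_add_sum hT (a := fun n => ‖grad Ω (D.discErr n)‖ ^ 2) (by positivity)
    (fun j => sq_nonneg _) (fun n h1 hn => ?_) hk hkN
  have h := D.error_equation hinj h1 hn
    (Submodule.sub_mem _ (D.discErr_mem (n := n + 1) (by omega) hn)
      (D.discErr_mem h1 (by omega)))
  rw [map_sub, map_sub] at h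
  exact energy_step_increment (timeStep_pos hT D.two_le_N) hν h

theorem sum_ritzErr (hΩ : IsOpen Ω) (hinj : Function.Injective (grad Ω)) (hT : 0 < T)
    (D : Model Ω ν T) {Y : Type*} [NormedAddCommGroup Y] [InnerProductSpace ℝ Y]
    (ι : H10 Ω →ₗ[ℝ] Y) :
    ∑ j ∈ Icc 1 D.N, podWeight T D.N j * ‖ι (D.ritzErr hinj (podData T D.N D.u j))‖ ^ 2 =
      ∑ i ∈ Icc (D.r + 1) D.s, D.eigenvalue i * ‖ι (D.φ i - D.R (D.φ i))‖ ^ 2 :=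
  D.sum_podData_tail hΩ hT (ι ∘ₗ D.ritzErr hinj) fun k h1 hk => by
    rw [LinearMap.comp_apply, D.ritzErr_mode hinj h1 hk, map_zero]

/-! ### Uniform error bounds -/

theorem hasErrorBound_L2 (hd : 1 ≤ d) (hΩ : IsOpen Ω) (hΩb : Bornology.IsBounded Ω)
    (hν : 0 < ν) (hT : 0 < T) :
    HasErrorBound (Set.univ : Set (Model Ω ν T)) (toL2 Ω) lamL2 lamInitL2 := by
  have hinj := grad_injective hd hΩ hΩb
  obtain ⟨P, -, hP⟩ := exists_poincare hd hΩb
  set c := P ^ 2 / (2 * ν) with hc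
  have hc0 : 0 ≤ c := by positivity
  -- The factor 2 comes from splitting the error, `1 + T` from the Ritz error and `c` from the load.
  refine ⟨2 * (1 + T) + 2 * c, by positivity, fun D _ k hk hkN => ?_⟩
  have h1 := D.norm_map_u_sq_le hT (toL2 Ω ∘ₗ D.ritzErr hinj) hk hkN
  have h2 := D.norm_discErr_sq_le hinj hν hT hP hk hkN
  simp only [LinearMap.comp_apply] at h1
  rw [D.sum_ritzErr hΩ hinj hT (toL2 Ω)] at h1 h2
  rw [D.err_eq hinj, map_sub]
  refine (norm_sub_sq_le _ _).trans ?_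
  have h3 : 0 ≤ D.lamInitL2 := sq_nonneg _
  change _ ≤ (1 + T) * D.lamL2 at h1
  change _ ≤ D.lamInitL2 + c * D.lamL2 at h2
  nlinarith [mul_nonneg hc0 h3, mul_nonneg hT.le h3]

theorem lamH10_eq (D : Model Ω ν T) : D.lamH10 =
    D.lamL2 + ∑ i ∈ Icc (D.r + 1) D.s, D.eigenvalue i * ‖grad Ω (D.φ i - D.R (D.φ i))‖ ^ 2 := by
  rw [lamH10, lamL2, ← Finset.sum_add_distrib]
  exact Finset.sum_congr rfl fun i _ => mul_add _ _ _

theorem lamL2_nonneg (D : Model Ω ν T) : 0 ≤ D.lamL2 :=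
  Finset.sum_nonneg fun i _ => mul_nonneg (D.eigenvalue_nonneg i) (sq_nonneg _)

theorem hasErrorBound_H10 (hd : 1 ≤ d) (hΩ : IsOpen Ω) (hΩb : Bornology.IsBounded Ω)
    (hν : 0 < ν) (hT : 0 < T) :
    HasErrorBound (Set.univ : Set (Model Ω ν T)) (grad Ω) lamH10 lamInitH10 := by
  have hinj := grad_injective hd hΩ hΩb
  set c := 1 / (2 * ν) with hc
  have hc0 : 0 ≤ c := by positivity
  refine ⟨2 * (1 + T) + 2 * c, by positivity, fun D _ k hk hkN => ?_⟩
  have h1 := D.norm_map_u_sq_le hT (grad Ω ∘ₗ D.ritzErr hinj) hk hkN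
  have h2 := D.norm_grad_discErr_sq_le hinj hν hT hk hkN
  simp only [LinearMap.comp_apply] at h1
  rw [D.sum_ritzErr hΩ hinj hT (grad Ω)] at h1
  rw [D.sum_ritzErr hΩ hinj hT (toL2 Ω)] at h2
  rw [D.err_eq hinj, map_sub]
  refine (norm_sub_sq_le _ _).trans ?_
  have h3 : 0 ≤ D.lamInitH10 := sq_nonneg _
  have h4 := D.lamL2_nonneg
  rw [D.lamH10_eq]
  set S := ∑ i ∈ Icc (D.r + 1) D.s, D.eigenvalue i * ‖grad Ω (D.φ i - D.R (D.φ i))‖ ^ 2 with hS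
  have h5 : 0 ≤ S :=
    Finset.sum_nonneg fun i _ => mul_nonneg (D.eigenvalue_nonneg i) (sq_nonneg _)
  change _ ≤ D.lamInitH10 + c * D.lamL2 at h2
  nlinarith [mul_nonneg hc0 h3, mul_nonneg hT.le h3, mul_nonneg hc0 h5, mul_nonneg hT.le h4]

/-! ### Optimality -/

/-- The map `w ↦ Πᵣ w - Rᵣ w`. -/
def projDiff (hinj : Function.Injective (grad Ω)) (D : Model Ω ν T) : H10 Ω →ₗ[ℝ] H10 Ω :=
  podProjLinear D.φ D.r - ritzLinear hinj (modeSpan D.φ D.r)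

theorem projDiff_apply (hinj : Function.Injective (grad Ω)) (D : Model Ω ν T) (w : H10 Ω) :
    D.projDiff hinj w = podProj D.φ D.r w - D.R w := rfl

theorem projDiff_mode (hinj : Function.Injective (grad Ω)) (D : Model Ω ν T) {k : ℕ} (h1 : 1 ≤ k)
    (hk : k ≤ D.r) : D.projDiff hinj (D.φ k) = 0 := by
  rw [projDiff_apply, D.podProj_mode h1 hk, R, ritz_self hinj _ (D.mode_mem h1 hk), sub_self]

/-- `φᵣ¹ = (Πᵣ - Rᵣ) u¹`, and `u¹` is itself a POD datum of weight 1, so one term of the POD sum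
controls it. The map `Πᵣ - Rᵣ` kills the first `r` modes and equals `-Rᵣ` on the remaining `φᵢ`, `i
≤ s`. -/
theorem norm_initErr_sq_le (hΩ : IsOpen Ω) (hinj : Function.Injective (grad Ω)) (hT : 0 < T)
    (D : Model Ω ν T) {Y : Type*} [NormedAddCommGroup Y] [InnerProductSpace ℝ Y]
    (ι : H10 Ω →ₗ[ℝ] Y) :
    ‖ι D.initErr‖ ^ 2 ≤ ∑ i ∈ Icc (D.r + 1) D.s, D.eigenvalue i * ‖ι (D.R (D.φ i))‖ ^ 2 := by
  have h := D.norm_map_init_sq_le hT (ι ∘ₗ D.projDiff hinj)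
  rw [D.sum_podData_tail hΩ hT (ι ∘ₗ D.projDiff hinj) fun k h1 hk => by
    rw [LinearMap.comp_apply, D.projDiff_mode hinj h1 hk, map_zero]] at h
  rw [LinearMap.comp_apply, projDiff_apply, ← D.ur_init] at h
  refine h.trans (Finset.sum_le_sum fun i hi => ?_)
  rw [mem_Icc] at hi
  rw [LinearMap.comp_apply, projDiff_apply, D.podProj_mode_of_lt (by omega) hi.2, zero_sub,
    map_neg, norm_neg]

theorem optimalI_L2 (hd : 1 ≤ d) (hΩ : IsOpen Ω) (hΩb : Bornology.IsBounded Ω) (hT : 0 < T)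
    (F : Set (Model Ω ν T)) {B : ℝ} (hB : ∀ D ∈ F, ∀ i, D.r + 1 ≤ i → i ≤ D.s →
      ‖toL2 Ω (D.φ i - D.R (D.φ i))‖ ≤ B) :
    OptimalI F (toL2 Ω) lamL2 lamInitL2 := by
  have hinj := grad_injective hd hΩ hΩb
  -- `B²` serves `Λᵣ`; `2 + 2B²` bounds `‖Rᵣ φᵢ‖²` by writing `Rᵣ φᵢ = φᵢ - (φᵢ - Rᵣ φᵢ)` with `‖φᵢ‖
  -- = 1`.
  refine ⟨B ^ 2 + (2 + 2 * B ^ 2), fun D hD => ?_⟩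
  rw [add_mul]
  have hb : ∀ i ∈ Icc (D.r + 1) D.s, ‖toL2 Ω (D.φ i - D.R (D.φ i))‖ ^ 2 ≤ B ^ 2 := fun i hi =>
    pow_le_pow_left₀ (norm_nonneg _) (hB D hD i (mem_Icc.1 hi).1 (mem_Icc.1 hi).2) 2
  have hn : ∀ i ∈ Icc (D.r + 1) D.s, ‖toL2 Ω (D.φ i)‖ ^ 2 = 1 := fun i hi =>
    D.norm_mode_sq (by have := (mem_Icc.1 hi).1; omega) (mem_Icc.1 hi).2
  refine add_le_add ?_ ((D.norm_initErr_sq_le hΩ hinj hT (toL2 Ω)).trans ?_)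
  · rw [lamL2, Finset.mul_sum]
    refine Finset.sum_le_sum fun i hi => ?_
    rw [hn i hi, mul_one, mul_comm]
    exact mul_le_mul_of_nonneg_right (hb i hi) (D.eigenvalue_nonneg i)
  · rw [Finset.mul_sum]
    refine Finset.sum_le_sum fun i hi => ?_
    rw [hn i hi, mul_one, mul_comm]
    refine mul_le_mul_of_nonneg_right ?_ (D.eigenvalue_nonneg i)
    have h := norm_sub_sq_le (toL2 Ω (D.φ i)) (toL2 Ω (D.φ i - D.R (D.φ i)))
    rw [← map_sub, sub_sub_cancel, hn i hi] at h
    linarith [hb i hi]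

theorem optimalI_H10 (hd : 1 ≤ d) (hΩ : IsOpen Ω) (hΩb : Bornology.IsBounded Ω) (hT : 0 < T) :
    OptimalI (Set.univ : Set (Model Ω ν T)) (grad Ω) lamH10 lamInitH10 := by
  have hinj := grad_injective hd hΩ hΩb
  obtain ⟨P, hP0, hP⟩ := exists_poincare hd hΩb
  -- `P²` and `1` serve the `L²` and gradient parts of `Λᵣ`; the last `1` serves `Λᵣ¹`.
  refine ⟨(P ^ 2 + 1) + 1, fun D _ => ?_⟩
  rw [add_mul (P ^ 2 + 1)]
  refine add_le_add ?_ ((D.norm_initErr_sq_le hΩ hinj hT (grad Ω)).trans ?_)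
  · rw [lamH10, Finset.mul_sum]
    refine Finset.sum_le_sum fun i _ => ?_
    rw [mul_left_comm]
    refine mul_le_mul_of_nonneg_left ?_ (D.eigenvalue_nonneg i)
    have h1 := pow_le_pow_left₀ (norm_nonneg _) (hP (D.φ i - D.R (D.φ i))) 2
    have h2 : ‖grad Ω (D.φ i - D.R (D.φ i))‖ ^ 2 ≤ ‖grad Ω (D.φ i)‖ ^ 2 :=
      le_of_le_of_eq (le_add_of_nonneg_right (sq_nonneg _))
        (norm_grad_sq_eq (modeSpan D.φ D.r) (D.φ i)).symm
    rw [mul_pow] at h1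
    nlinarith [mul_le_mul_of_nonneg_left h2 (sq_nonneg P)]
  · rw [one_mul]
    refine Finset.sum_le_sum fun i _ => mul_le_mul_of_nonneg_left ?_ (D.eigenvalue_nonneg i)
    exact le_of_le_of_eq (le_add_of_nonneg_left (sq_nonneg _))
      (norm_grad_sq_eq (modeSpan D.φ D.r) (D.φ i)).symm

end Model

end PODROM

end

open PODROM in
theorem mainTheorem10 {d : ℕ} (hd : 1 ≤ d) (Ω : Set (E d)) (hΩ : IsOpen Ω)
    (hΩb : Bornology.IsBounded Ω) (ν T : ℝ) (hν : 0 < ν) (hT : 0 < T) :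
    -- error norm `Y = L²`
    (HasErrorBound (Set.univ : Set (Model Ω ν T)) (toL2 Ω) Model.lamL2 Model.lamInitL2 ∧
      (∀ F : Set (Model Ω ν T),
        (∃ B : ℝ, ∀ D ∈ F, ∀ i, D.r + 1 ≤ i → i ≤ D.s →
          ‖toL2 Ω (D.φ i - D.R (D.φ i))‖ ≤ B) →
        OptimalI F (toL2 Ω) Model.lamL2 Model.lamInitL2 ∧
        OptimalII F (toL2 Ω) Model.lamL2 Model.lamInitL2) ∧
      (∀ F : Set (Model Ω ν T),
        OptimalI F (toL2 Ω) Model.lamL2 Model.lamInitL2 ↔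
          OptimalII F (toL2 Ω) Model.lamL2 Model.lamInitL2)) ∧
    -- error norm `Y = H₀¹`
    (HasErrorBound (Set.univ : Set (Model Ω ν T)) (grad Ω) Model.lamH10 Model.lamInitH10 ∧
      OptimalI (Set.univ : Set (Model Ω ν T)) (grad Ω) Model.lamH10 Model.lamInitH10) := by
  refine ⟨⟨Model.hasErrorBound_L2 hd hΩ hΩb hν hT, fun F hF => ?_,
    fun F => Model.optimalI_iff_optimalII_L2 F _ _⟩,
    Model.hasErrorBound_H10 hd hΩ hΩb hν hT, Model.optimalI_H10 hd hΩ hΩb hT⟩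
  obtain ⟨B, hB⟩ := hF
  have h := Model.optimalI_L2 hd hΩ hΩb hT F hB
  exact ⟨h, (Model.optimalI_iff_optimalII_L2 F _ _).1 h⟩
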